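/- A space is a \emph{$P$-space} if all its $G_\delta$ subsets are open. For a space $Z$, $Z_\delta$ is the set of points of $Z$ with the topology generated by the $G_\delta$ subsets of $Z$. The tightness $t(Z)$ is the least infinite cardinal $\mu$ such that whenever $z\in\overline{A}$, $A\subseteq Z$, there is $B\subseteq A$ with $|B|\le\mu$ and $z\in\overline{B}$. For spaces $X_\alpha$ $(\alpha<\kappa)$ with product $X=\prod_{\alpha<\kappa}X_\alpha$ and a point $x^*\in X$, the $\sigma$-product $\sigma(X,x^*)$ is the subspace of all $x\in X$ (in the Tychonoff topology) such that $\{\alpha<\kappa : x(\alpha)\neq x^*(\alpha)\}$ is finite. For an infinite cardinal $\lambda$, $\mathrm{Cov}_\omega(\lambda)=\mathrm{cf}([\lambda]^{\aleph_0},\subseteq)$ is the least cardinality of a family $\mathscr C$ of subsets of $\lambda$ of cardinality $\aleph_0$ such that every subset of $\lambda$ of cardinality $\aleph_0$ is contained in a member of $\mathscr C$. \textbf{Theorem.} (1) Let $\kappa$ be a cardinal, let $\lambda$ be an infinite cardinal with $\mathrm{Cov}_\omega(\lambda)=\lambda$, let $X_\alpha$ $(\alpha<\kappa)$ be regular Lindelöf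 $P$-spaces with $t(X_\alpha)\le\lambda$, let $X=\prod_{\alpha<\kappa}X_\alpha$ and let $x^*\in X$. Then \[ t\bigl(\sigma(X,x^*)_\delta\bigr)\le\lambda . \] (2) In particular, if $n\ge 1$ is an integer, $X$ is a regular Lindelöf $P$-space with $t(X)=\aleph_n$, $\kappa\ge 1$ is a cardinal and $x^*\in X^\kappa$, then \[ t\bigl(\sigma(X^\kappa,x^*)_\delta\bigr)=\aleph_n . \] Here regular spaces are not required to be $T_1$ (or $T_0$). -/

import Mathlib

open Cardinal

universe u

noncomputable section

/-- A P-space: every `G_δ` subset is open. -/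
def IsPSpace (X : Type u) [TopologicalSpace X] : Prop :=
  ∀ s : Set X, IsGδ s → IsOpen s

/-- The underlying set of `X`, to be equipped with the `G_δ`-topology. -/
def GDelta (X : Type u) : Type u := X

/-- The `G_δ`-topology: the topology generated by the `G_δ` subsets of `X`. -/
instance GDelta.instTopologicalSpace (X : Type u) [t : TopologicalSpace X] :
    TopologicalSpace (GDelta X) :=
  TopologicalSpace.generateFrom {s : Set X | @IsGδ X t s}

/-- `κ` bounds the tightness of `X`: a point of the closure of a set `A` lies in the closure of
some subset of `A` of cardinality at most `κ`. -/
def TightnessLE (X : Type u) [TopologicalSpace X] (κ : Cardinal.{u}) : Prop :=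
  ∀ (A : Set X) (x : X), x ∈ closure A → ∃ B : Set X, B ⊆ A ∧ #B ≤ κ ∧ x ∈ closure B

/-- The tightness `t(X)`: the least infinite cardinal that bounds the tightness of `X`. -/
def tightness (X : Type u) [TopologicalSpace X] : Cardinal.{u} :=
  sInf {κ : Cardinal.{u} | ℵ₀ ≤ κ ∧ TightnessLE X κ}

/-- The infimum defining the tightness is attained. -/
theorem tightness_mem (X : Type u) [TopologicalSpace X] :
    ℵ₀ ≤ tightness X ∧ TightnessLE X (tightness X) := by
  have h : {κ : Cardinal.{u} | ℵ₀ ≤ κ ∧ TightnessLE X κ}.Nonempty :=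
    ⟨max ℵ₀ #X, le_max_left _ _, fun A x hx =>
      ⟨A, subset_rfl, (mk_set_le A).trans (le_max_right _ _), hx⟩⟩
  exact csInf_mem h

/-- The `σ`-product at the base point `x₀`: the points of the Tychonoff product that differ from
`x₀` in finitely many coordinates only. Coerced to a type it carries the subspace topology. -/
def sigmaProduct {ι : Type u} {X : ι → Type u} (x₀ : ∀ i, X i) : Set (∀ i, X i) :=
  {x | {i | x i ≠ x₀ i}.Finite}

/-- `Cov_ω(κ) = cf([κ]^ℵ₀, ⊆)`: the least cardinality of a cofinal family in the set of all
subsets of `κ` of cardinality `ℵ₀`, ordered by inclusion. -/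
def covOmega (κ : Cardinal.{u}) : Cardinal.{u} :=
  Order.cof {s : Set κ.out // #s = ℵ₀}

end

/-! Fix `x` in the closure of `A`. The `G_δ`-modification is a P-space, so closure commutes with
countable unions and the points of `A` may be assumed to differ from `x` in at most `n` coordinates;
induct on `n`. Take a maximal subfamily of `A` with pairwise disjoint difference sets. If it is
uncountable, any `ℵ₁` of its members accumulate at `x`. If it is countable, its difference sets
cover a countable set of coordinates met by every difference set from `A`, so one coordinate `i` may
be assumed to lie in all of them. Resetting `i` lowers `n`, and the factor `X i` is restored by
`exists_small_subset_mem_closure_prod`, which rests on closed projections along Lindelöf factors.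
The covering hypothesis enters only through `ℵ₁ ≤ lam`. The lower bound in (2) comes from embedding
a factor. -/

open Set Filter Topology

/-! ### P-spaces -/

namespace IsPSpace

theorem of_nhds {X : Type u} [TopologicalSpace X]
    (h : ∀ (x : X) (U : ℕ → Set X), (∀ n, U n ∈ 𝓝 x) → ⋂ n, U n ∈ 𝓝 x) : IsPSpace X := by
  intro s hs
  obtain ⟨U, hU, rfl⟩ := hs.eq_iInter_nat
  exact isOpen_iff_mem_nhds.2 fun x hx =>
    h x U fun n => (hU n).mem_nhds (mem_iInter.1 hx n)

theorem iInter_mem_nhds {X : Type u} [TopologicalSpace X] (hX : IsPSpace X) {κ : Type*}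
    [Countable κ] {x : X} {U : κ → Set X} (hU : ∀ n, U n ∈ 𝓝 x) : ⋂ n, U n ∈ 𝓝 x := by
  have h : IsOpen (⋂ n, interior (U n)) :=
    hX _ (IsGδ.iInter_of_isOpen fun n => isOpen_interior)
  exact mem_of_superset (h.mem_nhds (mem_iInter.2 fun n => mem_interior_iff_mem_nhds.2 (hU n)))
    (iInter_mono fun n => interior_subset)

/-- In a P-space the closure commutes with countable unions. -/
theorem exists_mem_closure_of_mem_closure_iUnion {X : Type u} [TopologicalSpace X]
    (hX : IsPSpace X) {κ : Type*} [Countable κ] {x : X} {A : κ → Set X}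
    (hx : x ∈ closure (⋃ n, A n)) : ∃ n, x ∈ closure (A n) := by
  by_contra! h
  have h' : ∀ n, (A n)ᶜ ∈ 𝓝 x := fun n => by
    have := h n
    rwa [← mem_compl_iff, ← interior_compl, mem_interior_iff_mem_nhds] at this
  obtain ⟨y, hy, hyA⟩ := mem_closure_iff_nhds.1 hx _ (hX.iInter_mem_nhds h')
  obtain ⟨n, hn⟩ := mem_iUnion.1 hyA
  exact mem_iInter.1 hy n hn

theorem prod {X Y : Type u} [TopologicalSpace X] [TopologicalSpace Y]
    (hX : IsPSpace X) (hY : IsPSpace Y) : IsPSpace (X × Y) := by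
  refine of_nhds fun x U hU => ?_
  choose V hV W hW h using fun n => mem_nhds_prod_iff.1 (hU n)
  exact mem_of_superset (prod_mem_nhds (hX.iInter_mem_nhds hV) (hY.iInter_mem_nhds hW))
    fun p hp => mem_iInter.2 fun n =>
      h n ⟨mem_iInter.1 hp.1 n, mem_iInter.1 hp.2 n⟩

/-- The projection of a product along a Lindelöf factor onto a P-space is closed. -/
theorem isClosedMap_snd {X Y : Type u} [TopologicalSpace X] [TopologicalSpace Y]
    [LindelofSpace X] (hY : IsPSpace Y) : IsClosedMap (Prod.snd : X × Y → Y) := by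
  intro C hC
  rw [← isOpen_compl_iff, isOpen_iff_mem_nhds]
  intro y hy
  have hn : ∀ x : X, Cᶜ ∈ 𝓝 (x, y) := fun x =>
    hC.isOpen_compl.mem_nhds fun h => hy ⟨_, h, rfl⟩
  choose V hV W hW h using fun x => mem_nhds_prod_iff.1 (hn x)
  -- Tube lemma with a countable subcover: the P-space `Y` absorbs the countable intersection of the
  -- `W x`.
  obtain ⟨t, htc, ht⟩ := (isLindelof_univ (X := X)).elim_countable_subcover
    (fun x => interior (V x)) (fun x => isOpen_interior)
    fun x _ => mem_iUnion.2 ⟨x, mem_interior_iff_mem_nhds.2 (hV x)⟩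
  have := htc.to_subtype
  refine mem_of_superset (hY.iInter_mem_nhds fun x : t => hW x) ?_
  rintro _ hz ⟨⟨a, z⟩, haz, rfl⟩
  obtain ⟨x, hxt, hx⟩ := mem_iUnion₂.1 (ht (mem_univ a))
  exact h x ⟨interior_subset hx, mem_iInter.1 hz ⟨x, hxt⟩⟩ haz

end IsPSpace

/-! ### The `G_δ`-modification -/

namespace GDelta

variable {Z W : Type u} [TopologicalSpace Z] [TopologicalSpace W]

/-- The identity from the `G_δ`-modification to the original space. -/
def toOrig (z : GDelta Z) : Z := z

/-- The identity from a space to its `G_δ`-modification. -/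
def ofOrig (z : Z) : GDelta Z := z

theorem exists_isGδ_subset {x : GDelta Z} {s : Set (GDelta Z)} (hs : s ∈ 𝓝 x) :
    ∃ G : Set Z, IsGδ G ∧ x.toOrig ∈ G ∧ toOrig ⁻¹' G ⊆ s := by
  have hb := TopologicalSpace.isTopologicalBasis_of_subbasis_of_inter
    (t := GDelta.instTopologicalSpace Z) (r := {s : Set Z | IsGδ s}) rfl
    fun _ h₁ _ h₂ => IsGδ.inter h₁ h₂
  obtain ⟨G, hG, hx, hGs⟩ := hb.mem_nhds_iff.1 hs
  rcases hG with rfl | hG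
  · exact ⟨univ, IsGδ.univ, trivial, hGs⟩
  · exact ⟨G, hG, hx, hGs⟩

theorem isOpen_preimage_toOrig {G : Set Z} (hG : IsGδ G) :
    IsOpen (toOrig ⁻¹' G : Set (GDelta Z)) :=
  TopologicalSpace.isOpen_generateFrom_of_mem hG

theorem continuous_toOrig : Continuous (toOrig : GDelta Z → Z) :=
  ⟨fun _ hs => isOpen_preimage_toOrig hs.isGδ⟩

theorem isPSpace : IsPSpace (GDelta Z) := by
  refine IsPSpace.of_nhds fun x U hU => ?_
  choose G hG hx h using fun n => exists_isGδ_subset (hU n)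
  exact mem_of_superset
    ((isOpen_preimage_toOrig (IsGδ.iInter hG)).mem_nhds (mem_iInter.2 hx : x.toOrig ∈ _))
    fun y hy => mem_iInter.2 fun n => h n (mem_iInter.1 hy n)

theorem continuous_of_isPSpace (hZ : IsPSpace Z) {f : Z → GDelta W}
    (hf : Continuous fun z => (f z).toOrig) : Continuous f :=
  continuous_generateFrom_iff.2 fun s hs =>
    hZ _ (IsGδ.preimage (X := Z) (Y := W) (f := fun z => (f z).toOrig) (s := s) hf hs)

end GDelta

/-! ### Tightness -/

theorem TightnessLE.mono {X : Type u} [TopologicalSpace X] {κ μ : Cardinal.{u}}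
    (h : TightnessLE X κ) (hκ : κ ≤ μ) : TightnessLE X μ := fun A x hx =>
  let ⟨B, hBA, hB, hxB⟩ := h A x hx
  ⟨B, hBA, hB.trans hκ, hxB⟩

/-- A subset of the image of `A` is the image of a subset of `A` of the same cardinality. -/
theorem exists_subset_image_eq_mk_eq {X Y : Type u} {f : X → Y} {A : Set X} {B : Set Y}
    (hB : B ⊆ f '' A) : ∃ C ⊆ A, f '' C = B ∧ #C = #B := by
  obtain ⟨C, hCA, hC⟩ := exists_subset_bijOn (s := A ∩ f ⁻¹' B) (f := f)
  have hCB : f '' C = B := by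
    rw [hC.image_eq, image_inter_preimage, inter_eq_right.2 hB]
  exact ⟨C, hCA.trans inter_subset_left, hCB, by
    rw [← mk_image_eq_of_injOn f C hC.injOn, hCB]⟩

theorem TightnessLE.of_isInducing {X Y : Type u} [TopologicalSpace X] [TopologicalSpace Y]
    {κ : Cardinal.{u}} (h : TightnessLE Y κ) {f : X → Y} (hf : IsInducing f) :
    TightnessLE X κ := by
  intro A x hx
  rw [hf.closure_eq_preimage_closure_image] at hx
  obtain ⟨B, hBA, hB, hxB⟩ := h _ _ hx
  obtain ⟨C, hCA, hCB, hC⟩ := exists_subset_image_eq_mk_eq hBA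
  refine ⟨C, hCA, hC ▸ hB, ?_⟩
  rw [hf.closure_eq_preimage_closure_image, hCB]
  exact hxB

theorem tightness_le_iff {X : Type u} [TopologicalSpace X] {κ : Cardinal.{u}} (hκ : ℵ₀ ≤ κ) :
    tightness X ≤ κ ↔ TightnessLE X κ :=
  ⟨fun h => (tightness_mem X).2.mono h, fun h => csInf_le' ⟨hκ, h⟩⟩

/-- A pointwise form of Malykhin's theorem for a product of a regular Lindelöf space with a
P-space: if `κ` bounds the tightness of `Y`, and the tightness of `Z` at `z` with respect to
subsets of `D`, then it bounds the tightness of `Y × Z` at `(y, z)` with respect to sets that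
project into `D`. -/
theorem exists_small_subset_mem_closure_prod {Y Z : Type u} [TopologicalSpace Y]
    [TopologicalSpace Z] [RegularSpace Y] [LindelofSpace Y] (hZ : IsPSpace Z)
    {κ : Cardinal.{u}} (hκ : ℵ₀ ≤ κ) (hY : TightnessLE Y κ) {z : Z} {D : Set Z}
    (hD : ∀ A ⊆ D, z ∈ closure A → ∃ B ⊆ A, #B ≤ κ ∧ z ∈ closure B)
    {y : Y} {A : Set (Y × Z)} (hA : Prod.snd '' A ⊆ D) (h : (y, z) ∈ closure A) :
    ∃ B ⊆ A, #B ≤ κ ∧ (y, z) ∈ closure B := by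
  by_contra hcon
  -- `F` is the part of the slice over `z` that small subsets of `A` reach. Tightness of `Y` and `κ
  -- * κ = κ` keep `y` out of its closure.
  set F : Set Y := {y' | ∃ B ⊆ A, #B ≤ κ ∧ (y', z) ∈ closure B} with hF
  have hyF : y ∉ closure F := by
    intro hy
    obtain ⟨E, hEF, hE, hyE⟩ := hY F y hy
    choose B hBA hB hBz using fun e : E => hEF e.2
    refine hcon ⟨⋃ e, B e, iUnion_subset hBA, ?_, ?_⟩
    · calc #(⋃ e, B e) ≤ #E * ⨆ e, #(B e) := mk_iUnion_le B
        _ ≤ κ * κ := mul_le_mul' hE (ciSup_le' hB)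
        _ = κ := mul_eq_self hκ
    · have hmaps : MapsTo (fun y' => (y', z)) E (closure (⋃ e, B e)) := fun e he =>
        closure_mono (subset_iUnion B ⟨e, he⟩) (hBz ⟨e, he⟩)
      have := map_mem_closure (f := fun y' => (y', z)) (by fun_prop) hyE hmaps
      rwa [closure_closure] at this
  have hFn : Fᶜ ∈ 𝓝 y := by
    rwa [← mem_compl_iff, ← interior_compl, mem_interior_iff_mem_nhds] at hyF
  obtain ⟨V, hV, hVc, hVF⟩ := exists_mem_nhds_isClosed_subset hFn
  have hz : z ∈ closure (Prod.snd '' (A ∩ Prod.fst ⁻¹' V)) := by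
    refine mem_closure_iff_nhds.2 fun W hW => ?_
    obtain ⟨p, hp, hpA⟩ := mem_closure_iff_nhds.1 h _ (prod_mem_nhds hV hW)
    exact ⟨p.2, hp.2, p, ⟨hpA, hp.1⟩, rfl⟩
  obtain ⟨E, hEA, hE, hzE⟩ := hD _ ((image_mono inter_subset_left).trans hA) hz
  obtain ⟨B, hBA, hBE, hBc⟩ := exists_subset_image_eq_mk_eq hEA
  -- Closedness of the projection lifts `z` to a limit point of `B` over `V`, which would lie in
  -- `F`.
  have hcl : IsClosed (Prod.snd '' closure B) := hZ.isClosedMap_snd _ isClosed_closure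
  have hzB : z ∈ Prod.snd '' closure B :=
    closure_minimal (hBE ▸ image_mono subset_closure) hcl hzE
  obtain ⟨⟨y', _⟩, hyB, rfl⟩ := hzB
  have hyV : y' ∈ V :=
    closure_minimal (fun p hp => (hBA hp).2) (hVc.preimage continuous_fst) hyB
  exact hVF hyV ⟨B, hBA.trans inter_subset_left, hBc ▸ hE, hyB⟩

/-! ### Difference sets and `σ`-products -/

section SigmaProduct

variable {ι : Type u} {X : ι → Type u} {x₀ : ∀ i, X i}

open Classical in
/-- Change one coordinate of a point of a `σ`-product. -/
noncomputable def sigmaUpdate (i : ι) (a : X i) (y : sigmaProduct x₀) : sigmaProduct x₀ :=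
  ⟨Function.update y.1 i a, (Set.Finite.insert i y.2).subset fun j hj => by
    by_cases h : j = i
    · exact Or.inl h
    · right
      simpa [Function.update_of_ne h] using hj⟩

/-- The set of coordinates in which two points of a `σ`-product differ. -/
def diffSet (x y : sigmaProduct x₀) : Set ι := {i | y.1 i ≠ x.1 i}

theorem diffSet_finite (x y : sigmaProduct x₀) : (diffSet x y).Finite := by
  refine (Set.Finite.union x.2 y.2).subset fun i hi => ?_
  by_contra h
  simp only [mem_union, mem_ofPred_eq, not_or, not_not] at h
  exact hi (h.2.trans h.1.symm)

theorem eq_of_diffSet_eq_empty {x y : sigmaProduct x₀} (h : diffSet x y = ∅) : y = x := by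
  refine Subtype.ext (funext fun i => ?_)
  by_contra hi
  exact (h ▸ (show i ∈ diffSet x y from hi) : i ∈ (∅ : Set ι))

theorem sigmaUpdate_sigmaUpdate_self (i : ι) (a : X i) (y : sigmaProduct x₀) :
    sigmaUpdate i (y.1 i) (sigmaUpdate i a y) = y :=
  Subtype.ext (by simp [sigmaUpdate])

theorem sigmaUpdate_self (i : ι) (y : sigmaProduct x₀) : sigmaUpdate i (y.1 i) y = y :=
  Subtype.ext (by simp [sigmaUpdate])

theorem diffSet_sigmaUpdate_self (x y : sigmaProduct x₀) (i : ι) :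
    diffSet x (sigmaUpdate i (x.1 i) y) = diffSet x y \ {i} := by
  ext j
  by_cases h : j = i
  · subst h
    simp [diffSet, sigmaUpdate]
  · simp [diffSet, sigmaUpdate, h]

variable [∀ i, TopologicalSpace (X i)]

theorem continuous_sigmaUpdate (i : ι) :
    Continuous fun p : X i × sigmaProduct x₀ => sigmaUpdate i p.1 p.2 := by
  classical
  refine Continuous.subtype_mk ?_ _
  have : Continuous fun p : X i × sigmaProduct x₀ => Function.update p.2.1 i p.1 :=
    (continuous_subtype_val.comp continuous_snd).update i continuous_fst
  convert this

/-- A neighbourhood in the `G_δ`-topology of a `σ`-product depends on countably many coordinates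
only, as far as points agreeing with the centre there are concerned. -/
theorem exists_countable_of_mem_nhds {x : GDelta (sigmaProduct x₀)}
    {s : Set (GDelta (sigmaProduct x₀))} (hs : s ∈ 𝓝 x) :
    ∃ S : Set ι, S.Countable ∧ ∀ y : GDelta (sigmaProduct x₀),
      Disjoint (diffSet x.toOrig y.toOrig) S → y ∈ s := by
  obtain ⟨G, hG, hx, hGs⟩ := GDelta.exists_isGδ_subset hs
  obtain ⟨U, hU, rfl⟩ := hG.eq_iInter_nat
  have key : ∀ n, ∃ I : Finset ι, ∀ y : sigmaProduct x₀,
      Disjoint (diffSet x.toOrig y) I → y ∈ U n := by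
    intro n
    obtain ⟨V, hV, hVU⟩ := isOpen_induced_iff.1 (hU n)
    have hxV : x.toOrig.1 ∈ V := by
      have : x.toOrig ∈ U n := mem_iInter.1 hx n
      rwa [← hVU] at this
    obtain ⟨I, u, hu, hIV⟩ := isOpen_pi_iff.1 hV _ hxV
    refine ⟨I, fun y hy => ?_⟩
    rw [← hVU]
    refine hIV fun i hi => ?_
    have : y.1 i = x.toOrig.1 i := by
      by_contra h
      exact disjoint_left.1 hy h hi
    rw [this]
    exact (hu i hi).2
  choose I hI using key
  refine ⟨⋃ n, (I n : Set ι), countable_iUnion fun n => (I n).countable_toSet, fun y hy => ?_⟩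
  exact hGs (mem_iInter.2 fun n =>
    hI n _ (hy.mono_right (subset_iUnion (fun n => (I n : Set ι)) n)))

/-- An uncountable family of points whose difference sets from `x` are pairwise disjoint
accumulates at `x`. -/
theorem mem_closure_of_pairwise_disjoint {x : GDelta (sigmaProduct x₀)}
    {B : Set (GDelta (sigmaProduct x₀))} (hB : ¬ B.Countable)
    (hd : B.PairwiseDisjoint fun y => diffSet x.toOrig y.toOrig) : x ∈ closure B := by
  refine mem_closure_iff_nhds.2 fun s hs => ?_
  obtain ⟨S, hS, hSs⟩ := exists_countable_of_mem_nhds hs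
  by_contra hne
  refine hB ?_
  have hmeet : ∀ b : B, ∃ i ∈ S, i ∈ diffSet x.toOrig b.1.toOrig := by
    intro b
    by_contra! h
    exact hne ⟨b, hSs b (disjoint_right.2 h), b.2⟩
  choose f hfS hf using hmeet
  have := hS.to_subtype
  have hinj : Function.Injective fun b : B => (⟨f b, hfS b⟩ : S) := by
    intro b c hbc
    have hbc' : f b = f c := congrArg Subtype.val hbc
    by_contra hne'
    exact disjoint_left.1 (hd b.2 c.2 fun h => hne' (Subtype.ext h)) (hf b) (hbc' ▸ hf c)
  exact hinj.countable

/-- The induction step at one coordinate: `join ∘ split` is the identity, so the question moves to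
`X i` times the modification, where the second components lie in `D`. -/
theorem exists_small_subset_of_mem_diffSet (hP : ∀ i, IsPSpace (X i)) {lam : Cardinal.{u}}
    (hlam : ℵ₀ ≤ lam) (i : ι) [RegularSpace (X i)] [LindelofSpace (X i)]
    (ht : TightnessLE (X i) lam) {x : GDelta (sigmaProduct x₀)}
    {D : Set (GDelta (sigmaProduct x₀))}
    (hD : ∀ A ⊆ D, x ∈ closure A → ∃ B ⊆ A, #B ≤ lam ∧ x ∈ closure B)
    {A : Set (GDelta (sigmaProduct x₀))}
    (hA : ∀ y ∈ A, GDelta.ofOrig (sigmaUpdate i (x.toOrig.1 i) y.toOrig) ∈ D)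
    (hx : x ∈ closure A) : ∃ B ⊆ A, #B ≤ lam ∧ x ∈ closure B := by
  let split : GDelta (sigmaProduct x₀) → X i × GDelta (sigmaProduct x₀) := fun y =>
    (y.toOrig.1 i, GDelta.ofOrig (sigmaUpdate i (x.toOrig.1 i) y.toOrig))
  let join : X i × GDelta (sigmaProduct x₀) → GDelta (sigmaProduct x₀) := fun p =>
    GDelta.ofOrig (sigmaUpdate i p.1 p.2.toOrig)
  have hjoin : Continuous join :=
    GDelta.continuous_of_isPSpace (W := sigmaProduct x₀) (f := join)
      ((hP i).prod (GDelta.isPSpace (Z := sigmaProduct x₀)))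
      ((continuous_sigmaUpdate i).comp (continuous_id.prodMap
        (GDelta.continuous_toOrig (Z := sigmaProduct x₀))))
  have hcoord : Continuous fun y : GDelta (sigmaProduct x₀) => y.toOrig.1 i :=
    (continuous_apply i).comp (continuous_subtype_val.comp GDelta.continuous_toOrig)
  have hsplit : Continuous split :=
    hcoord.prodMk (hjoin.comp (continuous_const.prodMk continuous_id))
  have hjs : ∀ y, join (split y) = y := fun y => sigmaUpdate_sigmaUpdate_self _ _ y.toOrig
  have hsx : split x = (x.toOrig.1 i, x) :=
    Prod.ext rfl (sigmaUpdate_self i x.toOrig)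
  have hxs : (x.toOrig.1 i, x) ∈ closure (split '' A) :=
    hsx ▸ map_mem_closure hsplit hx (mapsTo_image split A)
  obtain ⟨E, hEA, hE, hxE⟩ := exists_small_subset_mem_closure_prod
    (GDelta.isPSpace (Z := sigmaProduct x₀)) hlam ht hD
    (by rintro _ ⟨_, ⟨y, hy, rfl⟩, rfl⟩; exact hA y hy) hxs
  obtain ⟨B, hBA, hBE, hBc⟩ := exists_subset_image_eq_mk_eq hEA
  refine ⟨B, hBA, hBc ▸ hE, ?_⟩
  rw [← hsx, ← hBE] at hxE
  have := map_mem_closure hjoin hxE (t := B)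
    (by rintro _ ⟨y, hy, rfl⟩; rwa [hjs])
  rwa [hjs] at this

theorem exists_small_subset_of_ncard_le (hR : ∀ i, RegularSpace (X i))
    (hL : ∀ i, LindelofSpace (X i)) (hP : ∀ i, IsPSpace (X i)) {lam : Cardinal.{u}}
    (hlam : ℵ₁ ≤ lam) (ht : ∀ i, TightnessLE (X i) lam) (x : GDelta (sigmaProduct x₀)) (n : ℕ) :
    ∀ A ⊆ {y : GDelta (sigmaProduct x₀) | (diffSet x.toOrig y.toOrig).ncard ≤ n},
      x ∈ closure A → ∃ B ⊆ A, #B ≤ lam ∧ x ∈ closure B := by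
  have hlam₀ : ℵ₀ ≤ lam := aleph0_lt_aleph_one.le.trans hlam
  have hself : ∀ A : Set (GDelta (sigmaProduct x₀)), x ∈ A →
      ∃ B ⊆ A, #B ≤ lam ∧ x ∈ closure B := fun A hxA =>
    ⟨{x}, singleton_subset_iff.2 hxA,
      (mk_singleton x).trans_le (one_le_aleph0.trans hlam₀), subset_closure rfl⟩
  induction n with
  | zero =>
    intro A hA hx
    obtain ⟨y, hy⟩ := closure_nonempty_iff.1 ⟨x, hx⟩
    have hy0 : diffSet x.toOrig y.toOrig = ∅ :=
      (ncard_eq_zero (diffSet_finite _ _)).1 (Nat.le_zero.1 (hA hy))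
    have hyx : y = x := eq_of_diffSet_eq_empty hy0
    exact hself A (hyx ▸ hy)
  | succ n ih =>
    intro A hA hx
    by_cases hxA : x ∈ A
    · exact hself A hxA
    obtain ⟨M, hM⟩ := zorn_subset
      {M : Set (GDelta (sigmaProduct x₀)) |
        M ⊆ A ∧ M.PairwiseDisjoint fun y => diffSet x.toOrig y.toOrig}
      fun c hc hchain => ⟨⋃₀ c, ⟨sUnion_subset fun s hs => (hc hs).1,
        (pairwiseDisjoint_sUnion hchain.directedOn).2 fun s hs => (hc hs).2⟩,
        fun s hs => subset_sUnion_of_mem hs⟩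
    by_cases hMc : M.Countable
    · set S : Set ι := ⋃ y ∈ M, diffSet x.toOrig y.toOrig with hS
      have hSc : S.Countable := hMc.biUnion fun y _ => (diffSet_finite _ _).countable
      have hmeet : ∀ y ∈ A, ∃ i ∈ S, i ∈ diffSet x.toOrig y.toOrig := by
        intro y hy
        by_contra! hcon
        -- A difference set missing `S` could be added to `M`; by maximality it is already there, so
        -- it is contained in `S` and hence empty.
        have hyM : y ∈ M := by
          refine hM.mem_of_prop_insert ⟨insert_subset hy hM.prop.1, ?_⟩
          refine hM.prop.2.insert fun z hz _ => disjoint_left.2 fun i hi hiz => ?_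
          exact hcon i (mem_biUnion hz hiz) hi
        have hy0 : diffSet x.toOrig y.toOrig = ∅ := eq_empty_of_forall_notMem fun i hi =>
          hcon i (mem_biUnion hyM hi) hi
        have hyx : y = x := eq_of_diffSet_eq_empty hy0
        exact hxA (hyx ▸ hy)
      have := hSc.to_subtype
      have hxU : x ∈ closure (⋃ i : S, {y ∈ A | i.1 ∈ diffSet x.toOrig y.toOrig}) :=
        closure_mono (fun y hy => by
          obtain ⟨i, hiS, hi⟩ := hmeet y hy
          exact mem_iUnion.2 ⟨⟨i, hiS⟩, hy, hi⟩) hx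
      obtain ⟨⟨i, _⟩, hi⟩ :=
    (GDelta.isPSpace (Z := sigmaProduct x₀)).exists_mem_closure_of_mem_closure_iUnion hxU
      have := hR i
      have := hL i
      obtain ⟨B, hBA, hB⟩ := exists_small_subset_of_mem_diffSet hP hlam₀ i (ht i) ih
        (fun y hy => by
          change (diffSet x.toOrig (sigmaUpdate i (x.toOrig.1 i) y.toOrig)).ncard ≤ n
          rw [diffSet_sigmaUpdate_self, ncard_sdiff_singleton_of_mem hy.2]
          exact Nat.sub_le_of_le_add (hA hy.1)) hi
      exact ⟨B, hBA.trans (sep_subset _ _), hB⟩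
    · have hM1 : ℵ₁ ≤ #M := by
        rw [← succ_aleph0, Order.succ_le_iff]
        exact not_le.1 fun h => hMc (le_aleph0_iff_set_countable.1 h)
      -- Exactly `ℵ₁` points: uncountable, yet at most `lam`.
      obtain ⟨B, hBM, hB⟩ := le_mk_iff_exists_subset.1 hM1
      refine ⟨B, hBM.trans hM.prop.1, hB ▸ hlam,
        mem_closure_of_pairwise_disjoint (fun hc => ?_) (hM.prop.2.subset hBM)⟩
      exact absurd (hB ▸ le_aleph0_iff_set_countable.2 hc) (not_le.2 aleph0_lt_aleph_one)

theorem tightnessLE_gDelta_sigmaProduct (hR : ∀ i, RegularSpace (X i))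
    (hL : ∀ i, LindelofSpace (X i)) (hP : ∀ i, IsPSpace (X i)) {lam : Cardinal.{u}}
    (hlam : ℵ₁ ≤ lam) (ht : ∀ i, TightnessLE (X i) lam) :
    TightnessLE (GDelta (sigmaProduct x₀)) lam := by
  intro A x hx
  have hxU : x ∈ closure (⋃ n : ℕ, {y ∈ A | (diffSet x.toOrig y.toOrig).ncard ≤ n}) :=
    closure_mono (fun y hy => by
      rw [mem_iUnion]
      exact ⟨(diffSet x.toOrig y.toOrig).ncard, hy, Nat.le_refl _⟩) hx
  obtain ⟨n, hn⟩ :=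
    (GDelta.isPSpace (Z := sigmaProduct x₀)).exists_mem_closure_of_mem_closure_iUnion hxU
  obtain ⟨B, hBA, hB⟩ :=
    exists_small_subset_of_ncard_le hR hL hP hlam ht x n _ (fun y hy => hy.2) hn
  exact ⟨B, hBA.trans (sep_subset _ _), hB⟩

/-- A P-space factor embeds into the `G_δ`-modification of the `σ`-product. -/
theorem isInducing_sigmaUpdate (i : ι) (hP : IsPSpace (X i)) (x : sigmaProduct x₀) :
    IsInducing fun a : X i => GDelta.ofOrig (sigmaUpdate i a x) := by
  have hcont : Continuous fun a : X i => GDelta.ofOrig (sigmaUpdate i a x) :=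
    GDelta.continuous_of_isPSpace hP
      ((continuous_sigmaUpdate i).comp (continuous_id.prodMk continuous_const))
  have hcoord : Continuous fun y : GDelta (sigmaProduct x₀) => y.toOrig.1 i :=
    (continuous_apply i).comp (continuous_subtype_val.comp GDelta.continuous_toOrig)
  refine IsInducing.of_comp (X := X i) (Y := GDelta (sigmaProduct x₀)) hcont hcoord ?_
  have : (fun y : GDelta (sigmaProduct x₀) => y.toOrig.1 i) ∘
      (fun a : X i => GDelta.ofOrig (sigmaUpdate i a x)) = id :=
    by classical exact funext fun a => (by simp [sigmaUpdate] : (sigmaUpdate i a x).1 i = a)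
  rw [this]
  exact IsInducing.id

end SigmaProduct

/-! ### The covering number and the conclusion -/

theorem covOmega_aleph0_le_one : covOmega ℵ₀ ≤ 1 := by
  have hu : #(univ : Set (Quotient.out ℵ₀)) = ℵ₀ := by rw [mk_univ, mk_out]
  refine (Order.cof_le (s := {⟨univ, hu⟩}) fun s => ⟨_, rfl, ?_⟩).trans_eq (mk_singleton _)
  exact subset_univ s.1

/-- At `ℵ₀` the whole set is a one-element cofinal family, so `ℵ₀` is not a fixed point of
`covOmega`. -/
theorem aleph_one_le_of_covOmega_eq {lam : Cardinal.{u}} (h₀ : ℵ₀ ≤ lam)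
    (h : covOmega lam = lam) : ℵ₁ ≤ lam := by
  rw [← succ_aleph0, Order.succ_le_iff]
  refine lt_of_le_of_ne h₀ fun he => ?_
  subst he
  exact (one_lt_aleph0.trans_le h.ge).not_ge covOmega_aleph0_le_one

theorem mainTheorem5 :
    (∀ (ι : Type u) (X : ι → Type u) [∀ i, TopologicalSpace (X i)]
        (x₀ : ∀ i, X i) (lam : Cardinal.{u}),
      (∀ i, RegularSpace (X i)) → (∀ i, LindelofSpace (X i)) → (∀ i, IsPSpace (X i)) →
      ℵ₀ ≤ lam → covOmega lam = lam → (∀ i, tightness (X i) ≤ lam) →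
      tightness (GDelta (sigmaProduct x₀)) ≤ lam) ∧
    (∀ (ι : Type u) [Nonempty ι] (X : Type u) [TopologicalSpace X]
        (x₀ : ι → X) (n : ℕ),
      RegularSpace X → LindelofSpace X → IsPSpace X →
      1 ≤ n → tightness X = aleph (n : Ordinal.{u}) →
      tightness (GDelta (sigmaProduct x₀)) = aleph (n : Ordinal.{u})) := by
  refine ⟨fun ι X _ x₀ lam hR hL hP h₀ hcov ht => ?_, fun ι _ X _ x₀ n hR hL hP hn ht => ?_⟩
  · exact (tightness_le_iff h₀).2 (tightnessLE_gDelta_sigmaProduct hR hL hP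
      (aleph_one_le_of_covOmega_eq h₀ hcov) fun i => (tightness_le_iff h₀).1 (ht i))
  · have h₁ : ℵ₁ ≤ aleph (n : Ordinal.{u}) := aleph_le_aleph.2 (by exact_mod_cast hn)
    refine le_antisymm ((tightness_le_iff (aleph0_le_aleph _)).2
      (tightnessLE_gDelta_sigmaProduct (fun _ => hR) (fun _ => hL) (fun _ => hP) h₁
        fun _ => ht ▸ (tightness_mem X).2)) ?_
    obtain ⟨i⟩ := ‹Nonempty ι›
    have hσ := tightness_mem (GDelta (sigmaProduct x₀))
    rw [← ht, tightness_le_iff hσ.1]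
    exact hσ.2.of_isInducing (isInducing_sigmaUpdate i hP (x₀ := x₀) ⟨x₀, by simp [sigmaProduct]⟩)
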